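/- Let $Q$ be a finite quiver (multiple arrows allowed, no loops, no directed $2$-cycles) with vertex set $V$ and a bipartition $\epsilon\colon V\to\{0,1\}$ ($\epsilon_u\ne\epsilon_v$ whenever $u,v$ are joined by an arrow). Assume that $Q$ is recurrent: the combined mutation at all vertices with $\epsilon=0$, and likewise the combined mutation at all vertices with $\epsilon=1$, reverses all arrows of $Q$ and has no other effect. Let $\mathbf x=\{x_v\}_{v\in V}$ be indeterminates. The $T$-system of $Q$ is the family $T_v(t)\in\mathbb{Q}(\mathbf x)$, for $v\in V$, $t\in\mathbb Z$ with $t+\epsilon_v$ even, determined by $$T_v(t+1)\,T_v(t-1)=\prod_{u\to v}T_u(t)+\prod_{v\to w}T_w(t)\quad(t+\epsilon_v\text{ odd}),\qquad T_v(\epsilon_v)=x_v .$$ For $\lambda\colon V\to\mathbb R$ the tropical $T$-system is the family $\mathfrak t^\lambda_v(t)\in\mathbb R$, for $t+\epsilon_v$ even, determined by $$\mathfrak t^\lambda_v(t+1)+\mathfrak t^\lambda_v(t-1)=\max\Big(\sum_{u\to v}\mathfrak t^\lambda_u(t),\ \sum_{v\to w}\mathfrak t^\lambda_w(t)\Big)\quad(t+\epsilon_v\text{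 odd}),\qquad \mathfrak t^\lambda_v(\epsilon_v)=\lambda(v).$$ (Products and sums are over all arrows.) Let $\deg_{\max}(u,f)$ and $\deg_{\min}(u,f)$ denote the maximal and the minimal degree of $x_u$ in $f$: for a nonzero Laurent polynomial $f$, such as $T_v(t)$, the largest and the smallest exponent of $x_u$ occurring in $f$; for a quotient $f=p/q$ of nonzero polynomials, the difference of these degrees of $p$ and $q$. Let $\delta_u\colon V\to\mathbb R$ be given by $\delta_u(u)=1$ and $\delta_u(v)=0$ for $v\neq u$. Then for all $u,v\in V$ and all $t\in\mathbb Z$ with $t+\epsilon_v$ even: - if $\epsilon_u=0$, then $-\deg_{\min}(u,T_v(t))=\deg_{\max}(u,T_v(t+2))=\mathfrak t^{\delta_u}_v(t+2)$; - if $\epsilon_u=1$, then $-\deg_{\min}(u,T_v(t))=\deg_{\max}(u,T_v(t-2))=\mathfrak t^{\delta_u}_v(t-2)$. -/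

import Mathlib

open scoped BigOperators

noncomputable section

/-- A quiver on the vertex set `V`: a directed graph, with multiple arrows allowed, without loops
and without directed `2`-cycles. `arrows u v` is the number of arrows `u → v`. -/
@[ext]
structure ArrowQuiver (V : Type*) where
  arrows : V → V → ℕ
  no_loop : ∀ v, arrows v v = 0
  no_two_cycle : ∀ u v, arrows u v = 0 ∨ arrows v u = 0

namespace ArrowQuiver

variable {V : Type*}

/-- The quiver with the directions of all arrows reversed. -/
def opposite (Q : ArrowQuiver V) : ArrowQuiver V where
  arrows u v := Q.arrows v u
  no_loop := Q.no_loop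
  no_two_cycle u v := Q.no_two_cycle v u

/-- Quiver mutation at the vertex `k`: for each pair of arrows `i → k`, `k → j` create an arrow
`i → j`; reverse all arrows at `k`; cancel directed `2`-cycles until there are none left. -/
def mutate [DecidableEq V] (Q : ArrowQuiver V) (k : V) : ArrowQuiver V where
  arrows i j :=
    if i = k ∨ j = k then Q.arrows j i
    else (Q.arrows i j + Q.arrows i k * Q.arrows k j)
      - (Q.arrows j i + Q.arrows j k * Q.arrows k i)
  no_loop v := by
    split_ifs
    · exact Q.no_loop v
    · exact Nat.sub_self _
  no_two_cycle u v := by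
    by_cases h : u = k ∨ v = k
    · rw [if_pos h, if_pos h.symm]
      exact Q.no_two_cycle v u
    · rw [if_neg h, if_neg (fun h' => h h'.symm)]
      omega

/-- Successive mutation at the vertices of a list. -/
def mutateList [DecidableEq V] (Q : ArrowQuiver V) (l : List V) : ArrowQuiver V :=
  l.foldl mutate Q

/-- `ε : V → {0, 1}` is a bipartition: the ends of every arrow have different colors. -/
def IsBipartition (Q : ArrowQuiver V) (ε : V → Fin 2) : Prop :=
  ∀ u v, Q.arrows u v ≠ 0 → ε u ≠ ε v

/-- The combined mutation at all vertices of color `c` (these mutations commute for a bipartite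
quiver, so the order that `Finset.toList` chooses is immaterial). -/
def mutateColor [Fintype V] [DecidableEq V] (Q : ArrowQuiver V) (ε : V → Fin 2) (c : Fin 2) :
    ArrowQuiver V :=
  Q.mutateList (Finset.univ.filter fun v => ε v = c).toList

/-- A bipartite quiver is recurrent if the combined mutation at all white vertices (`ε = 0`) and
the combined mutation at all black vertices (`ε = 1`) each reverse the directions of the arrows
and have no other effect. -/
def IsRecurrent [Fintype V] [DecidableEq V] (Q : ArrowQuiver V) (ε : V → Fin 2) : Prop :=
  ∀ c : Fin 2, Q.mutateColor ε c = Q.opposite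

end ArrowQuiver

/-- The field `ℚ(x)` of rational functions in the indeterminates `x_v`, `v ∈ V`. -/
abbrev RationalField (V : Type*) : Type _ := FractionRing (MvPolynomial V ℚ)

/-- The indeterminate `x_v` in `ℚ(x)`. -/
def xvar {V : Type*} (v : V) : RationalField V :=
  algebraMap (MvPolynomial V ℚ) (RationalField V) (MvPolynomial.X v)

/-! ### Two-step recurrences on `ℤ` -/

/-- The solution for `n = 0, 1, 2, …` of `s (n + 2) = step (s (n + 1)) (s n)`, with
`s 0 = s 1 = init`. -/
def evolveNat {S : Type*} (step : S → S → S) (init : S) : ℕ → S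
  | 0 => init
  | 1 => init
  | n + 2 => step (evolveNat step init (n + 1)) (evolveNat step init n)

/-- The extension to all times `t ∈ ℤ`. For `t ≤ 1` the same rule is applied in the negative
direction of time, `s (t - 2) = step (s (t - 1)) (s t)`. -/
def evolve {S : Type*} (step : S → S → S) (init : S) (t : ℤ) : S :=
  if 0 ≤ t then evolveNat step init t.toNat else evolveNat step init (1 - t).toNat

theorem evolve_zero {S : Type*} (step : S → S → S) (init : S) : evolve step init 0 = init := rfl

theorem evolve_one {S : Type*} (step : S → S → S) (init : S) : evolve step init 1 = init := rfl

theorem evolve_of_pos {S : Type*} (step : S → S → S) (init : S) {t : ℤ} (ht : 0 < t) :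
    evolve step init (t + 1) = step (evolve step init t) (evolve step init (t - 1)) := by
  obtain ⟨n, rfl⟩ : ∃ n : ℕ, t = (n : ℤ) + 1 := ⟨(t - 1).toNat, by omega⟩
  have e1 : ((n : ℤ) + 1 + 1).toNat = n + 2 := by omega
  have e2 : ((n : ℤ) + 1).toNat = n + 1 := by omega
  have e3 : ((n : ℤ) + 1 - 1).toNat = n := by omega
  unfold evolve
  rw [if_pos (by omega), if_pos (by omega), if_pos (by omega), e1, e2, e3, evolveNat]

theorem evolve_of_nonpos {S : Type*} (step : S → S → S) (init : S) {t : ℤ} (ht : t ≤ 0) :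
    evolve step init (t - 1) = step (evolve step init t) (evolve step init (t + 1)) := by
  have key : ∀ s : ℤ, s ≤ 1 → evolve step init s = evolveNat step init (1 - s).toNat := by
    intro s hs
    rcases lt_or_ge s 0 with h | h
    · exact if_neg (by omega)
    · obtain rfl | rfl : s = 0 ∨ s = 1 := by omega
      · rfl
      · rfl
  obtain ⟨n, rfl⟩ : ∃ n : ℕ, t = -(n : ℤ) := ⟨(-t).toNat, by omega⟩
  have e1 : (1 - (-(n : ℤ) - 1)).toNat = n + 2 := by omega
  have e2 : (1 - -(n : ℤ)).toNat = n + 1 := by omega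
  have e3 : (1 - (-(n : ℤ) + 1)).toNat = n := by omega
  rw [key _ (by omega), key _ (by omega), key _ (by omega), e1, e2, e3, evolveNat]

namespace ArrowQuiver

variable {V : Type*} [Fintype V]

/-! ### The (birational) `T`-system -/

/-- `∏_{u → v} f u + ∏_{v → w} f w`, the products being over all arrows. -/
def exchange {K : Type*} [Field K] (Q : ArrowQuiver V) (f : V → K) (v : V) : K :=
  ∏ u, f u ^ Q.arrows u v + ∏ w, f w ^ Q.arrows v w

/-- The `T`-system of `Q`: `Q.tSystem v t` is `T_v(t) ∈ ℚ(x)`. Only the values with `t + ε_v` even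
are of interest; they are determined by each other and by `T_v(ε_v) = x_v`. The remaining values,
which form an independent copy of the system, are normalized by `T_v(1 - ε_v) = x_v`. -/
def tSystem (Q : ArrowQuiver V) (v : V) (t : ℤ) : RationalField V :=
  evolve (fun cur prev v => Q.exchange cur v / prev v) xvar t v

/-! ### The tropical `T`-system -/

/-- `max (∑_{u → v} f u) (∑_{v → w} f w)`, the sums being over all arrows. -/
def tropicalExchange (Q : ArrowQuiver V) (f : V → ℝ) (v : V) : ℝ :=
  max (∑ u, (Q.arrows u v : ℝ) * f u) (∑ w, (Q.arrows v w : ℝ) * f w)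

/-- The tropical `T`-system of `Q` with initial values `lam`. As above, only the values
with `t + ε_v` even are of interest. -/
def tropicalTSystem (Q : ArrowQuiver V) (lam : V → ℝ) (v : V) (t : ℤ) : ℝ :=
  evolve (fun cur prev v => Q.tropicalExchange cur v - prev v) lam t v

/-! The defining relations and initial conditions of both systems. -/

theorem tropicalTSystem_init (Q : ArrowQuiver V) (lam : V → ℝ) (ε : V → Fin 2) (v : V) :
    Q.tropicalTSystem lam v ((ε v : ℕ) : ℤ) = lam v := by
  unfold tropicalTSystem
  generalize ε v = c
  fin_cases c <;> rfl

theorem tropicalTSystem_relation (Q : ArrowQuiver V) (lam : V → ℝ) (v : V) (t : ℤ) :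
    Q.tropicalTSystem lam v (t + 1) + Q.tropicalTSystem lam v (t - 1) =
      max (∑ u, (Q.arrows u v : ℝ) * Q.tropicalTSystem lam u t)
        (∑ w, (Q.arrows v w : ℝ) * Q.tropicalTSystem lam w t) := by
  unfold tropicalTSystem
  rcases lt_or_ge 0 t with h | h
  · rw [evolve_of_pos _ _ h, sub_add_cancel]
    rfl
  · rw [evolve_of_nonpos _ _ h, add_sub_cancel]
    rfl

theorem tSystem_init (Q : ArrowQuiver V) (ε : V → Fin 2) (v : V) :
    Q.tSystem v ((ε v : ℕ) : ℤ) = xvar v := by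
  unfold tSystem
  generalize ε v = c
  fin_cases c <;> rfl

section positivity

variable {V : Type*}

/-- Quotients of polynomials that are positive at the point `(1, 1, …, 1)`. -/
def PosAtOne (f : RationalField V) : Prop :=
  ∃ p q : MvPolynomial V ℚ, 0 < MvPolynomial.eval 1 p ∧ 0 < MvPolynomial.eval 1 q ∧
    f = algebraMap _ (RationalField V) p / algebraMap _ (RationalField V) q

theorem algebraMap_ne_zero_of_eval {p : MvPolynomial V ℚ} (hp : 0 < MvPolynomial.eval 1 p) :
    algebraMap (MvPolynomial V ℚ) (RationalField V) p ≠ 0 := by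
  have : p ≠ 0 := by
    rintro rfl
    simp at hp
  simpa using this

theorem PosAtOne.ne_zero {f : RationalField V} (hf : PosAtOne f) : f ≠ 0 := by
  obtain ⟨p, q, hp, hq, rfl⟩ := hf
  exact div_ne_zero (algebraMap_ne_zero_of_eval hp) (algebraMap_ne_zero_of_eval hq)

theorem PosAtOne.one : PosAtOne (1 : RationalField V) := ⟨1, 1, by simp, by simp, by simp⟩

theorem PosAtOne.mul {f g : RationalField V} (hf : PosAtOne f) (hg : PosAtOne g) :
    PosAtOne (f * g) := by
  obtain ⟨p, q, hp, hq, rfl⟩ := hf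
  obtain ⟨r, s, hr, hs, rfl⟩ := hg
  refine ⟨p * r, q * s, ?_, ?_, ?_⟩
  · rw [map_mul]; positivity
  · rw [map_mul]; positivity
  · rw [map_mul, map_mul, div_mul_div_comm]

theorem PosAtOne.inv {f : RationalField V} (hf : PosAtOne f) : PosAtOne f⁻¹ := by
  obtain ⟨p, q, hp, hq, rfl⟩ := hf
  exact ⟨q, p, hq, hp, inv_div _ _⟩

theorem PosAtOne.add {f g : RationalField V} (hf : PosAtOne f) (hg : PosAtOne g) :
    PosAtOne (f + g) := by
  obtain ⟨p, q, hp, hq, rfl⟩ := hf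
  obtain ⟨r, s, hr, hs, rfl⟩ := hg
  refine ⟨p * s + q * r, q * s, ?_, ?_, ?_⟩
  · rw [map_add, map_mul, map_mul]; positivity
  · rw [map_mul]; positivity
  · rw [div_add_div _ _ (algebraMap_ne_zero_of_eval hq) (algebraMap_ne_zero_of_eval hs)]
    simp only [map_add, map_mul]

theorem PosAtOne.pow {f : RationalField V} (hf : PosAtOne f) (n : ℕ) : PosAtOne (f ^ n) := by
  induction n with
  | zero => simpa using PosAtOne.one
  | succ n ih => rw [pow_succ]; exact ih.mul hf

theorem PosAtOne.prod [Fintype V] {f : V → RationalField V} (hf : ∀ v, PosAtOne (f v)) :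
    PosAtOne (∏ v, f v) :=
  Finset.prod_induction f PosAtOne (fun _ _ => PosAtOne.mul) PosAtOne.one fun v _ => hf v

end positivity

theorem posAtOne_evolveNat (Q : ArrowQuiver V) (n : ℕ) : ∀ v, PosAtOne
    (evolveNat (fun cur prev v => Q.exchange cur v / prev v) (xvar : V → RationalField V) n v) := by
  have hx : ∀ v : V, PosAtOne (xvar v) := fun v =>
    ⟨MvPolynomial.X v, 1, by simp, by simp, by simp [xvar]⟩
  induction n using Nat.twoStepInduction with
  | zero => exact hx
  | one => exact hx
  | more n ih1 ih2 =>
    intro v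
    rw [evolveNat, div_eq_mul_inv]
    exact ((PosAtOne.prod fun u => (ih2 u).pow _).add
      (PosAtOne.prod fun w => (ih2 w).pow _)).mul (ih1 v).inv

theorem tSystem_ne_zero (Q : ArrowQuiver V) (v : V) (t : ℤ) : Q.tSystem v t ≠ 0 := by
  unfold tSystem evolve
  split_ifs <;> exact (posAtOne_evolveNat Q _ v).ne_zero

theorem tSystem_relation (Q : ArrowQuiver V) (v : V) (t : ℤ) :
    Q.tSystem v (t + 1) * Q.tSystem v (t - 1) =
      ∏ u, Q.tSystem u t ^ Q.arrows u v + ∏ w, Q.tSystem w t ^ Q.arrows v w := by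
  have h1 := Q.tSystem_ne_zero v (t - 1)
  have h2 := Q.tSystem_ne_zero v (t + 1)
  unfold tSystem at h1 h2 ⊢
  rcases lt_or_ge 0 t with h | h
  · rw [evolve_of_pos _ _ h, div_mul_cancel₀ _ h1]
    rfl
  · rw [evolve_of_nonpos _ _ h, mul_div_cancel₀ _ h2]
    rfl

end ArrowQuiver

/-! ### Maximal and minimal degrees

`laurentDegMax`, `laurentDegMin` are the maximal and minimal exponent of `x_u` in a Laurent
polynomial. They are extended to all rational functions by
`deg (p / q) = deg p - deg q` for polynomials `p, q`. -/

section degrees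

variable {V : Type*}

/-- The least exponent of `x_u` in a (nonzero) polynomial. The greatest one is
`MvPolynomial.degreeOf u p`. -/
def lowDegreeOf (u : V) (p : MvPolynomial V ℚ) : ℕ :=
  sInf ((fun m : V →₀ ℕ => m u) '' (p.support : Set (V →₀ ℕ)))

/-- The maximal degree of `x_u` in `f ∈ ℚ(x)`. -/
def degMax (u : V) (f : RationalField V) : ℤ :=
  ((IsFractionRing.num (MvPolynomial V ℚ) f).degreeOf u : ℤ) -
    (((IsFractionRing.den (MvPolynomial V ℚ) f : MvPolynomial V ℚ)).degreeOf u : ℤ)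

/-- The minimal degree of `x_u` in `f ∈ ℚ(x)`. -/
def degMin (u : V) (f : RationalField V) : ℤ :=
  (lowDegreeOf u (IsFractionRing.num (MvPolynomial V ℚ) f) : ℤ) -
    (lowDegreeOf u (IsFractionRing.den (MvPolynomial V ℚ) f : MvPolynomial V ℚ) : ℤ)

/-- The ring `ℤ[x^{±1}]` of Laurent polynomials. -/
abbrev LaurentRing (V : Type*) : Type _ := AddMonoidAlgebra ℤ (V →₀ ℤ)

/-- The Laurent polynomial `p = ∑ c_α x^α` as an element of `ℚ(x)`. -/
def laurentToRat (p : LaurentRing V) : RationalField V :=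
  p.coeff.sum fun α c => (c : RationalField V) * α.prod fun v k => xvar v ^ k

/-- The greatest exponent of `x_u` in a (nonzero) Laurent polynomial. -/
def laurentDegMax (u : V) (p : LaurentRing V) : ℤ :=
  sSup ((fun α : V →₀ ℤ => α u) '' (p.coeff.support : Set (V →₀ ℤ)))

/-- The least exponent of `x_u` in a (nonzero) Laurent polynomial. -/
def laurentDegMin (u : V) (p : LaurentRing V) : ℤ :=
  sInf ((fun α : V →₀ ℤ => α u) '' (p.coeff.support : Set (V →₀ ℤ)))

theorem X_pow_dvd_iff_le (u : V) (n : ℕ) (p : MvPolynomial V ℚ) :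
    (MvPolynomial.X u) ^ n ∣ p ↔ ∀ m ∈ p.support, n ≤ m u := by
  rw [MvPolynomial.X_pow_eq_monomial, MvPolynomial.monomial_one_dvd_iff_modMonomial_eq_zero]
  constructor
  · intro h m hm
    by_contra hlt
    have hle : ¬ Finsupp.single u n ≤ m := by
      rw [Finsupp.single_le_iff]
      exact hlt
    have := MvPolynomial.coeff_modMonomial_of_not_le p hle
    rw [h, MvPolynomial.coeff_zero] at this
    exact (MvPolynomial.mem_support_iff.mp hm) this.symm
  · intro h
    ext m
    by_cases hle : Finsupp.single u n ≤ m
    · simp [MvPolynomial.coeff_modMonomial_of_le p hle]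
    · rw [MvPolynomial.coeff_modMonomial_of_not_le p hle, MvPolynomial.coeff_zero]
      by_contra hne
      exact hle (Finsupp.single_le_iff.mpr (h m (MvPolynomial.mem_support_iff.mpr hne)))

theorem emultiplicity_X_eq (u : V) {p : MvPolynomial V ℚ} (hp : p ≠ 0) :
    emultiplicity (MvPolynomial.X u) p = lowDegreeOf u p := by
  have hne : ((fun m : V →₀ ℕ => m u) '' (p.support : Set (V →₀ ℕ))).Nonempty :=
    (Finset.coe_nonempty.mpr (MvPolynomial.support_nonempty.mpr hp)).image _
  rw [emultiplicity_eq_coe, X_pow_dvd_iff_le, X_pow_dvd_iff_le]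
  refine ⟨fun m hm => Nat.sInf_le ⟨m, hm, rfl⟩, fun h => ?_⟩
  obtain ⟨m, hm, hmu⟩ := Nat.sInf_mem hne
  have := h m hm
  unfold lowDegreeOf at this
  simp only at hmu
  omega

theorem lowDegreeOf_mul (u : V) {p q : MvPolynomial V ℚ} (hp : p ≠ 0) (hq : q ≠ 0) :
    lowDegreeOf u (p * q) = lowDegreeOf u p + lowDegreeOf u q := by
  have h := emultiplicity_mul (a := p) (b := q) (MvPolynomial.X_prime (R := ℚ) (i := u))
  rw [emultiplicity_X_eq u hp, emultiplicity_X_eq u hq, emultiplicity_X_eq u (mul_ne_zero hp hq)]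
    at h
  exact_mod_cast h

theorem num_mul_eq {f : RationalField V} {p q : MvPolynomial V ℚ} (hq : q ≠ 0)
    (hf : f = algebraMap _ (RationalField V) p / algebraMap _ (RationalField V) q) :
    IsFractionRing.num (MvPolynomial V ℚ) f * q =
      p * (IsFractionRing.den (MvPolynomial V ℚ) f : MvPolynomial V ℚ) := by
  have hq' : algebraMap (MvPolynomial V ℚ) (RationalField V) q ≠ 0 := by simpa using hq
  have hd : algebraMap (MvPolynomial V ℚ) (RationalField V)
      (IsFractionRing.den (MvPolynomial V ℚ) f) ≠ 0 := by
    simp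
  have h := IsFractionRing.mk'_num_den' (MvPolynomial V ℚ) f
  rw [hf, div_eq_div_iff (by rwa [← hf]) hq', ← map_mul, ← map_mul, ← hf] at h
  exact IsFractionRing.injective _ _ h

/-- `degMax` does not depend on the choice of numerator and denominator. -/
theorem degMax_eq (u : V) {f : RationalField V} {p q : MvPolynomial V ℚ} (hp : p ≠ 0) (hq : q ≠ 0)
    (hf : f = algebraMap _ (RationalField V) p / algebraMap _ (RationalField V) q) :
    degMax u f = (p.degreeOf u : ℤ) - (q.degreeOf u : ℤ) := by
  have h := num_mul_eq hq hf
  have hd := nonZeroDivisors.ne_zero (IsFractionRing.den (MvPolynomial V ℚ) f).2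
  have hn : IsFractionRing.num (MvPolynomial V ℚ) f ≠ 0 := by
    intro h0
    rw [h0, zero_mul] at h
    exact mul_ne_zero hp hd h.symm
  have := congrArg (MvPolynomial.degreeOf u) h
  rw [MvPolynomial.degreeOf_mul_eq hn hq, MvPolynomial.degreeOf_mul_eq hp hd] at this
  unfold degMax
  omega

/-- `degMin` does not depend on the choice of numerator and denominator. -/
theorem degMin_eq (u : V) {f : RationalField V} {p q : MvPolynomial V ℚ} (hp : p ≠ 0) (hq : q ≠ 0)
    (hf : f = algebraMap _ (RationalField V) p / algebraMap _ (RationalField V) q) :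
    degMin u f = (lowDegreeOf u p : ℤ) - (lowDegreeOf u q : ℤ) := by
  have h := num_mul_eq hq hf
  have hd := nonZeroDivisors.ne_zero (IsFractionRing.den (MvPolynomial V ℚ) f).2
  have hn : IsFractionRing.num (MvPolynomial V ℚ) f ≠ 0 := by
    intro h0
    rw [h0, zero_mul] at h
    exact mul_ne_zero hp hd h.symm
  have := congrArg (lowDegreeOf u) h
  rw [lowDegreeOf_mul u hn hq, lowDegreeOf_mul u hp hd] at this
  unfold degMin
  omega

/-- A Laurent polynomial as the quotient of a polynomial, with the exponents shifted by a large
`N`, by a monomial. -/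
theorem laurent_shift [Fintype V] {p : LaurentRing V} (hp : p ≠ 0) :
    ∃ (N : ℕ) (s : (V →₀ ℤ) → (V →₀ ℕ)) (P : MvPolynomial V ℚ),
      (∀ α ∈ p.coeff.support, ∀ v, (s α v : ℤ) = α v + N) ∧
      (∀ m, m ∈ P.support ↔ ∃ α ∈ p.coeff.support, s α = m) ∧ P ≠ 0 ∧
      laurentToRat p = algebraMap _ (RationalField V) P / algebraMap _ (RationalField V)
        (MvPolynomial.monomial (Finsupp.equivFunOnFinite.symm fun _ : V => N) (1 : ℚ)) := by
  classical
  obtain ⟨N, hN⟩ : ∃ N : ℕ, ∀ α ∈ p.coeff.support, ∀ v, 0 ≤ α v + (N : ℤ) := by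
    refine ⟨∑ α ∈ p.coeff.support, ∑ v, (α v).natAbs, fun α hα v => ?_⟩
    have h1 : (α v).natAbs ≤ ∑ v, (α v).natAbs :=
      Finset.single_le_sum (f := fun v => (α v).natAbs) (fun _ _ => Nat.zero_le _)
        (Finset.mem_univ v)
    have h2 : ∑ v, (α v).natAbs ≤ ∑ α ∈ p.coeff.support, ∑ v, (α v).natAbs :=
      Finset.single_le_sum (f := fun α : V →₀ ℤ => ∑ v, (α v).natAbs)
        (fun _ _ => Nat.zero_le _) hα
    omega
  let s : (V →₀ ℤ) → (V →₀ ℕ) := fun α =>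
    Finsupp.equivFunOnFinite.symm fun v => (α v + (N : ℤ)).toNat
  have hs : ∀ α ∈ p.coeff.support, ∀ v, (s α v : ℤ) = α v + N := by
    intro α hα v
    exact Int.toNat_of_nonneg (hN α hα v)
  have hinj : ∀ α ∈ p.coeff.support, ∀ β ∈ p.coeff.support, s α = s β → α = β := by
    intro α hα β hβ h
    ext v
    have := congrArg (fun m : V →₀ ℕ => (m v : ℤ)) h
    simp only [hs α hα, hs β hβ] at this
    omega
  let P : MvPolynomial V ℚ :=
    ∑ α ∈ p.coeff.support, MvPolynomial.monomial (s α) (p.coeff α : ℚ)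
  have hcoeff : ∀ m, P.coeff m =
      ∑ α ∈ p.coeff.support, if s α = m then (p.coeff α : ℚ) else 0 := by
    intro m
    simp only [P, MvPolynomial.coeff_sum, MvPolynomial.coeff_monomial]
  have hsupp : ∀ m, m ∈ P.support ↔ ∃ α ∈ p.coeff.support, s α = m := by
    intro m
    rw [MvPolynomial.mem_support_iff, hcoeff]
    constructor
    · intro h
      obtain ⟨α, hα, h'⟩ := Finset.exists_ne_zero_of_sum_ne_zero h
      refine ⟨α, hα, ?_⟩
      by_contra hne
      exact h' (if_neg hne)
    · rintro ⟨α, hα, rfl⟩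
      rw [Finset.sum_eq_single_of_mem α hα, if_pos rfl]
      · exact_mod_cast Finsupp.mem_support_iff.mp hα
      · intro β hβ hne
        exact if_neg fun h => hne (hinj β hβ α hα h)
  have hmon : ∀ (m : V →₀ ℕ) (c : ℚ), algebraMap _ (RationalField V) (MvPolynomial.monomial m c) =
      (c : RationalField V) * ∏ v, xvar v ^ m v := by
    intro m c
    rw [MvPolynomial.monomial_eq, map_mul, Finsupp.prod_fintype _ _ (fun _ => pow_zero _),
      map_prod]
    congr 1
    · rw [← MvPolynomial.algebraMap_eq, ← IsScalarTower.algebraMap_apply]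
      exact eq_ratCast _ c
    · simp only [map_pow, xvar]
  have hx : ∀ v : V, (xvar v : RationalField V) ≠ 0 := by
    intro v
    simp [xvar]
  refine ⟨N, s, P, hs, hsupp, ?_, ?_⟩
  · obtain ⟨α, hα⟩ := Finsupp.support_nonempty_iff.mpr
      (AddMonoidAlgebra.coeff_eq_zero.not.mpr hp)
    rw [← MvPolynomial.support_nonempty]
    exact ⟨s α, (hsupp _).mpr ⟨α, hα, rfl⟩⟩
  · have hR : (∏ v : V, (xvar v : RationalField V) ^ N) ≠ 0 :=
      Finset.prod_ne_zero_iff.mpr fun v _ => pow_ne_zero _ (hx v)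
    rw [hmon, eq_div_iff (by simpa using hR)]
    simp only [P, map_sum, hmon, laurentToRat, Finsupp.sum, Finset.sum_mul]
    refine Finset.sum_congr rfl fun α hα => ?_
    rw [Finsupp.prod_fintype _ _ (fun _ => zpow_zero _)]
    simp only [Finsupp.equivFunOnFinite_symm_apply_apply, Rat.cast_one, one_mul, mul_assoc,
      ← Finset.prod_mul_distrib, Rat.cast_intCast]
    congr 1
    refine Finset.prod_congr rfl fun v _ => ?_
    rw [← zpow_natCast, ← zpow_natCast, ← zpow_add₀ (hx v), hs α hα]

/-- On Laurent polynomials, `degMax u` is the maximal exponent of `x_u`. -/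
theorem degMax_laurent [Fintype V] (u : V) {p : LaurentRing V} (hp : p ≠ 0) :
    degMax u (laurentToRat p) = laurentDegMax u p := by
  obtain ⟨N, s, P, hs, hsupp, hP, hf⟩ := laurent_shift hp
  rw [degMax_eq u hP (by simp) hf]
  obtain ⟨a, ha, hmax⟩ := Finset.exists_max_image p.coeff.support (fun α => α u)
    (Finsupp.support_nonempty_iff.mpr (AddMonoidAlgebra.coeff_eq_zero.not.mpr hp))
  have h1 : laurentDegMax u p = a u := by
    refine IsGreatest.csSup_eq ⟨⟨a, ha, rfl⟩, ?_⟩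
    rintro _ ⟨α, hα, rfl⟩
    exact hmax α hα
  have h2 : P.degreeOf u = s a u := by
    rw [MvPolynomial.degreeOf_eq_sup]
    refine le_antisymm (Finset.sup_le fun m hm => ?_)
      (Finset.le_sup (f := fun m : V →₀ ℕ => m u) ((hsupp _).mpr ⟨a, ha, rfl⟩))
    obtain ⟨α, hα, rfl⟩ := (hsupp m).mp hm
    have := hmax α hα
    have e1 := hs α hα u
    have e2 := hs a ha u
    omega
  rw [MvPolynomial.degreeOf_monomial_eq _ _ one_ne_zero, h1, h2, hs a ha]
  simp

/-- On Laurent polynomials, `degMin u` is the minimal exponent of `x_u`. -/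
theorem degMin_laurent [Fintype V] (u : V) {p : LaurentRing V} (hp : p ≠ 0) :
    degMin u (laurentToRat p) = laurentDegMin u p := by
  obtain ⟨N, s, P, hs, hsupp, hP, hf⟩ := laurent_shift hp
  rw [degMin_eq u hP (by simp) hf]
  obtain ⟨a, ha, hmin⟩ := Finset.exists_min_image p.coeff.support (fun α => α u)
    (Finsupp.support_nonempty_iff.mpr (AddMonoidAlgebra.coeff_eq_zero.not.mpr hp))
  have h1 : laurentDegMin u p = a u := by
    refine IsLeast.csInf_eq ⟨⟨a, ha, rfl⟩, ?_⟩
    rintro _ ⟨α, hα, rfl⟩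
    exact hmin α hα
  have h2 : lowDegreeOf u P = s a u := by
    refine IsLeast.csInf_eq ⟨⟨s a, (hsupp _).mpr ⟨a, ha, rfl⟩, rfl⟩, ?_⟩
    rintro _ ⟨m, hm, rfl⟩
    obtain ⟨α, hα, rfl⟩ := (hsupp m).mp hm
    have := hmin α hα
    have e1 := hs α hα u
    have e2 := hs a ha u
    simp only
    omega
  have h3 : lowDegreeOf u (MvPolynomial.monomial (Finsupp.equivFunOnFinite.symm fun _ : V => N)
      (1 : ℚ)) = N := by
    classical
    simp [lowDegreeOf, MvPolynomial.support_monomial]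
  rw [h1, h2, h3, hs a ha]
  simp

end degrees

end

/-! The maximal degree in `x_u` turns products into sums, and turns sums into maxima as long as
leading terms cannot cancel. Every `T_v(t)` is a quotient of nonzero polynomials with nonnegative
coefficients, so cancellation never occurs, and `degMax u` maps the `T`-system to a solution of the
tropical `T`-system with initial values `δ_u`. Likewise `-degMin u` gives a solution with initial
values `-δ_u` (`isTropicalSolution_of_tropicalization`).

A tropical solution is determined by its values at the times `ε_v`
(`IsTropicalSolution.eq_of_init`), so `degMax` is the tropical system `𝔱` for `δ_u`. It remains to
see that `𝔱`, shifted by `2` or `-2` according to the color of `u`, has initial values `-δ_u`. Start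
from `δ_u` on the color of `u`, followed by `0` on the other color. One step gives `0 - δ_u = -δ_u`.
In the next step the maximum is taken over two sums that are `≤ 0`, one of which is `0` because
there are no directed 2-cycles; hence the other color stays at `0` (`IsTropicalSolution.two_steps`).
-/

/-! ### Subtraction-free rational functions -/

section subtractionFree

variable {V : Type*}

/-- Quotients of nonzero polynomials with nonnegative coefficients. -/
def SubtractionFree (f : RationalField V) : Prop :=
  ∃ p q : MvPolynomial V ℚ, p ≠ 0 ∧ q ≠ 0 ∧ (∀ m, 0 ≤ p.coeff m) ∧ (∀ m, 0 ≤ q.coeff m) ∧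
    f = algebraMap _ (RationalField V) p / algebraMap _ (RationalField V) q

theorem coeff_mul_nonneg {p q : MvPolynomial V ℚ} (hp : ∀ m, 0 ≤ p.coeff m)
    (hq : ∀ m, 0 ≤ q.coeff m) (m : V →₀ ℕ) : 0 ≤ (p * q).coeff m := by
  classical
  rw [MvPolynomial.coeff_mul]
  exact Finset.sum_nonneg fun x _ => mul_nonneg (hp _) (hq _)

/-- Nonnegative coefficients cannot cancel. This is what makes degrees of sums exact maxima and
minima. -/
theorem mem_support_add_iff {p q : MvPolynomial V ℚ} (hp : ∀ m, 0 ≤ p.coeff m)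
    (hq : ∀ m, 0 ≤ q.coeff m) (m : V →₀ ℕ) :
    m ∈ (p + q).support ↔ m ∈ p.support ∨ m ∈ q.support := by
  simp only [MvPolynomial.mem_support_iff, MvPolynomial.coeff_add, ne_eq,
    add_eq_zero_iff_of_nonneg (hp m) (hq m), not_and_or]

theorem degreeOf_add_of_nonneg (u : V) {p q : MvPolynomial V ℚ} (hp : ∀ m, 0 ≤ p.coeff m)
    (hq : ∀ m, 0 ≤ q.coeff m) :
    (p + q).degreeOf u = max (p.degreeOf u) (q.degreeOf u) := by
  classical
  have h : (p + q).support = p.support ∪ q.support := by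
    ext m
    rw [mem_support_add_iff hp hq, Finset.mem_union]
  simp only [MvPolynomial.degreeOf_eq_sup, h, Finset.sup_union]

/-- Unlike for the maximal degree, both summands must be nonzero: the infimum of the empty set is
`0` in `ℕ`, so a zero summand would spoil the minimum. -/
theorem lowDegreeOf_add_of_nonneg (u : V) {p q : MvPolynomial V ℚ} (hp0 : p ≠ 0) (hq0 : q ≠ 0)
    (hp : ∀ m, 0 ≤ p.coeff m) (hq : ∀ m, 0 ≤ q.coeff m) :
    lowDegreeOf u (p + q) = min (lowDegreeOf u p) (lowDegreeOf u q) := by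
  have h : ((p + q).support : Set (V →₀ ℕ)) =
      (p.support : Set (V →₀ ℕ)) ∪ (q.support : Set (V →₀ ℕ)) := by
    ext m
    simpa using mem_support_add_iff hp hq m
  unfold lowDegreeOf
  rw [h, Set.image_union]
  exact csInf_union (OrderBot.bddBelow _)
    ((Finset.coe_nonempty.mpr (MvPolynomial.support_nonempty.mpr hp0)).image _)
    (OrderBot.bddBelow _)
    ((Finset.coe_nonempty.mpr (MvPolynomial.support_nonempty.mpr hq0)).image _)

theorem add_ne_zero_of_nonneg {p q : MvPolynomial V ℚ} (hp0 : p ≠ 0)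
    (hp : ∀ m, 0 ≤ p.coeff m) (hq : ∀ m, 0 ≤ q.coeff m) : p + q ≠ 0 := by
  obtain ⟨m, hm⟩ := MvPolynomial.support_nonempty.mpr hp0
  exact MvPolynomial.support_nonempty.mp ⟨m, (mem_support_add_iff hp hq m).mpr (Or.inl hm)⟩

namespace SubtractionFree

variable {f g : RationalField V}

theorem one : SubtractionFree (1 : RationalField V) := by
  classical
  have h : ∀ m, 0 ≤ (1 : MvPolynomial V ℚ).coeff m := by
    intro m
    rw [MvPolynomial.coeff_one]
    split_ifs <;> norm_num
  exact ⟨1, 1, one_ne_zero, one_ne_zero, h, h, by simp⟩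

theorem xvar (v : V) : SubtractionFree (xvar v) := by
  classical
  refine ⟨MvPolynomial.X v, 1, MvPolynomial.X_ne_zero v, one_ne_zero, fun m => ?_, fun m => ?_,
    by simp [_root_.xvar]⟩
  · rw [MvPolynomial.coeff_X]
    split_ifs <;> norm_num
  · rw [MvPolynomial.coeff_one]
    split_ifs <;> norm_num

theorem inv (hf : SubtractionFree f) : SubtractionFree f⁻¹ := by
  obtain ⟨p, q, hp0, hq0, hp, hq, rfl⟩ := hf
  exact ⟨q, p, hq0, hp0, hq, hp, inv_div _ _⟩

theorem mul (hf : SubtractionFree f) (hg : SubtractionFree g) : SubtractionFree (f * g) := by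
  obtain ⟨p, q, hp0, hq0, hp, hq, rfl⟩ := hf
  obtain ⟨r, s, hr0, hs0, hr, hs, rfl⟩ := hg
  exact ⟨p * r, q * s, mul_ne_zero hp0 hr0, mul_ne_zero hq0 hs0, coeff_mul_nonneg hp hr,
    coeff_mul_nonneg hq hs, by rw [map_mul, map_mul, div_mul_div_comm]⟩

theorem add (hf : SubtractionFree f) (hg : SubtractionFree g) : SubtractionFree (f + g) := by
  obtain ⟨p, q, hp0, hq0, hp, hq, rfl⟩ := hf
  obtain ⟨r, s, hr0, hs0, hr, hs, rfl⟩ := hg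
  have hps := coeff_mul_nonneg hp hs
  have hqr := coeff_mul_nonneg hq hr
  refine ⟨p * s + q * r, q * s, add_ne_zero_of_nonneg (mul_ne_zero hp0 hs0) hps hqr,
    mul_ne_zero hq0 hs0, fun m => ?_, coeff_mul_nonneg hq hs, ?_⟩
  · rw [MvPolynomial.coeff_add]
    exact add_nonneg (hps m) (hqr m)
  · rw [div_add_div _ _ (by simpa using hq0) (by simpa using hs0)]
    simp only [map_add, map_mul]

theorem pow (hf : SubtractionFree f) (n : ℕ) : SubtractionFree (f ^ n) := by
  induction n with
  | zero => simpa using one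
  | succ n ih => rw [pow_succ]; exact ih.mul hf

theorem prod [Fintype V] {f : V → RationalField V} (hf : ∀ v, SubtractionFree (f v)) :
    SubtractionFree (∏ v, f v) :=
  Finset.prod_induction f SubtractionFree (fun _ _ => mul) one fun v _ => hf v

end SubtractionFree

/-! ### Degrees as tropicalizations -/

theorem exists_num_den {f : RationalField V} (hf : f ≠ 0) :
    ∃ p q : MvPolynomial V ℚ, p ≠ 0 ∧ q ≠ 0 ∧
      f = algebraMap _ (RationalField V) p / algebraMap _ (RationalField V) q := by
  obtain ⟨p, q, hq, rfl⟩ := IsFractionRing.div_surjective (A := MvPolynomial V ℚ) f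
  refine ⟨p, q, ?_, nonZeroDivisors.ne_zero hq, rfl⟩
  rintro rfl
  simp at hf

/-- Zero is excluded because the zero polynomial has `degreeOf` equal to `0`, which breaks
additivity. -/
theorem degMax_mul (u : V) {f g : RationalField V} (hf : f ≠ 0) (hg : g ≠ 0) :
    degMax u (f * g) = degMax u f + degMax u g := by
  obtain ⟨p, q, hp, hq, rfl⟩ := exists_num_den hf
  obtain ⟨r, s, hr, hs, rfl⟩ := exists_num_den hg
  rw [degMax_eq u (mul_ne_zero hp hr) (mul_ne_zero hq hs)
    (by rw [map_mul, map_mul, div_mul_div_comm]), degMax_eq u hp hq rfl, degMax_eq u hr hs rfl,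
    MvPolynomial.degreeOf_mul_eq hp hr, MvPolynomial.degreeOf_mul_eq hq hs]
  push_cast
  ring

theorem degMin_mul (u : V) {f g : RationalField V} (hf : f ≠ 0) (hg : g ≠ 0) :
    degMin u (f * g) = degMin u f + degMin u g := by
  obtain ⟨p, q, hp, hq, rfl⟩ := exists_num_den hf
  obtain ⟨r, s, hr, hs, rfl⟩ := exists_num_den hg
  rw [degMin_eq u (mul_ne_zero hp hr) (mul_ne_zero hq hs)
    (by rw [map_mul, map_mul, div_mul_div_comm]), degMin_eq u hp hq rfl, degMin_eq u hr hs rfl,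
    lowDegreeOf_mul u hp hr, lowDegreeOf_mul u hq hs]
  push_cast
  ring

/-- Over the common denominator `q * s` the numerator `p * s + q * r` has no cancellation; for
general `f` and `g` the top terms could cancel. -/
theorem degMax_add (u : V) {f g : RationalField V} (hf : SubtractionFree f)
    (hg : SubtractionFree g) : degMax u (f + g) = max (degMax u f) (degMax u g) := by
  obtain ⟨p, q, hp0, hq0, hp, hq, rfl⟩ := hf
  obtain ⟨r, s, hr0, hs0, hr, hs, rfl⟩ := hg
  have hps := coeff_mul_nonneg hp hs
  have hqr := coeff_mul_nonneg hq hr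
  rw [degMax_eq u (add_ne_zero_of_nonneg (mul_ne_zero hp0 hs0) hps hqr) (mul_ne_zero hq0 hs0)
    (by
      rw [div_add_div _ _ (by simpa using hq0) (by simpa using hs0)]
      simp only [map_add, map_mul]),
    degMax_eq u hp0 hq0 rfl, degMax_eq u hr0 hs0 rfl, degreeOf_add_of_nonneg u hps hqr,
    MvPolynomial.degreeOf_mul_eq hp0 hs0, MvPolynomial.degreeOf_mul_eq hq0 hr0,
    MvPolynomial.degreeOf_mul_eq hq0 hs0]
  omega

theorem degMin_add (u : V) {f g : RationalField V} (hf : SubtractionFree f)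
    (hg : SubtractionFree g) : degMin u (f + g) = min (degMin u f) (degMin u g) := by
  obtain ⟨p, q, hp0, hq0, hp, hq, rfl⟩ := hf
  obtain ⟨r, s, hr0, hs0, hr, hs, rfl⟩ := hg
  have hps := coeff_mul_nonneg hp hs
  have hqr := coeff_mul_nonneg hq hr
  rw [degMin_eq u (add_ne_zero_of_nonneg (mul_ne_zero hp0 hs0) hps hqr) (mul_ne_zero hq0 hs0)
    (by
      rw [div_add_div _ _ (by simpa using hq0) (by simpa using hs0)]
      simp only [map_add, map_mul]),
    degMin_eq u hp0 hq0 rfl, degMin_eq u hr0 hs0 rfl,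
    lowDegreeOf_add_of_nonneg u (mul_ne_zero hp0 hs0) (mul_ne_zero hq0 hr0) hps hqr,
    lowDegreeOf_mul u hp0 hs0, lowDegreeOf_mul u hq0 hr0, lowDegreeOf_mul u hq0 hs0]
  omega

theorem degMax_xvar [DecidableEq V] (u v : V) :
    degMax u (xvar v) = if u = v then 1 else 0 := by
  rw [degMax_eq u (MvPolynomial.X_ne_zero v) one_ne_zero (by simp [xvar]),
    MvPolynomial.degreeOf_X]
  split_ifs <;> simp

theorem degMin_xvar [DecidableEq V] (u v : V) :
    degMin u (xvar v) = if u = v then 1 else 0 := by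
  rw [degMin_eq u (MvPolynomial.X_ne_zero v) one_ne_zero (by simp [xvar])]
  have h1 : lowDegreeOf u (1 : MvPolynomial V ℚ) = 0 := by
    -- Additivity applied to `1 * 1 = 1` forces the value `0`.
    have := lowDegreeOf_mul u (one_ne_zero (α := MvPolynomial V ℚ)) one_ne_zero
    rw [mul_one] at this
    omega
  have h2 : lowDegreeOf u (MvPolynomial.X v : MvPolynomial V ℚ) = if u = v then 1 else 0 := by
    simp [lowDegreeOf, MvPolynomial.support_X, Finsupp.single_apply, eq_comm]
  rw [h1, h2]
  split_ifs <;> simp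

end subtractionFree

/-! ### Tropicalization of the `T`-system -/

namespace ArrowQuiver

variable {V : Type*} [Fintype V]

/-- The recurrence uses only addition, multiplication and division. -/
theorem subtractionFree_evolveNat (Q : ArrowQuiver V) (n : ℕ) : ∀ v, SubtractionFree
    (evolveNat (fun cur prev v => Q.exchange cur v / prev v) (xvar : V → RationalField V) n v) := by
  induction n using Nat.twoStepInduction with
  | zero => exact SubtractionFree.xvar
  | one => exact SubtractionFree.xvar
  | more n ih1 ih2 =>
    intro v
    rw [evolveNat, div_eq_mul_inv]
    exact ((SubtractionFree.prod fun u => (ih2 u).pow _).add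
      (SubtractionFree.prod fun w => (ih2 w).pow _)).mul (ih1 v).inv

theorem subtractionFree_tSystem (Q : ArrowQuiver V) (v : V) (t : ℤ) :
    SubtractionFree (Q.tSystem v t) := by
  unfold tSystem evolve
  split_ifs <;> exact subtractionFree_evolveNat Q _ v

/-- The relation of the tropical `T`-system of `Q`. -/
def IsTropicalSolution (Q : ArrowQuiver V) (f : V → ℤ → ℝ) : Prop :=
  ∀ v t, f v (t + 1) + f v (t - 1) =
    max (∑ u, (Q.arrows u v : ℝ) * f u t) (∑ w, (Q.arrows v w : ℝ) * f w t)

/-- A map to the max-plus semifield that is multiplicative, and additive on subtraction-free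
elements, sends the `T`-system to a solution of the tropical `T`-system. -/
theorem isTropicalSolution_of_tropicalization (Q : ArrowQuiver V) (D : RationalField V → ℤ)
    (hmul : ∀ f g, f ≠ 0 → g ≠ 0 → D (f * g) = D f + D g)
    (hadd : ∀ f g, SubtractionFree f → SubtractionFree g → D (f + g) = max (D f) (D g)) :
    Q.IsTropicalSolution fun v t => (D (Q.tSystem v t) : ℝ) := by
  have hone : D 1 = 0 := by
    have := hmul 1 1 one_ne_zero one_ne_zero
    rw [mul_one] at this
    omega
  have hpow : ∀ f, f ≠ 0 → ∀ n : ℕ, D (f ^ n) = n * D f := by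
    intro f hf n
    induction n with
    | zero => simpa using hone
    | succ n ih =>
      rw [pow_succ, hmul _ _ (pow_ne_zero _ hf) hf, ih]
      push_cast
      ring
  have hprod : ∀ f : V → RationalField V, (∀ v, f v ≠ 0) → ∀ s : Finset V,
      D (∏ v ∈ s, f v) = ∑ v ∈ s, D (f v) := by
    classical
    intro f hf s
    induction s using Finset.induction_on with
    | empty => simpa using hone
    | insert a s ha ih =>
      rw [Finset.prod_insert ha, Finset.sum_insert ha,
        hmul _ _ (hf a) (Finset.prod_ne_zero_iff.mpr fun v _ => hf v), ih]
  intro v t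
  have h := congrArg D (Q.tSystem_relation v t)
  rw [hmul _ _ (Q.tSystem_ne_zero _ _) (Q.tSystem_ne_zero _ _),
    hadd _ _ (.prod fun u => (Q.subtractionFree_tSystem u t).pow _)
      (.prod fun u => (Q.subtractionFree_tSystem u t).pow _),
    hprod _ (fun u => pow_ne_zero _ (Q.tSystem_ne_zero _ _)),
    hprod _ (fun u => pow_ne_zero _ (Q.tSystem_ne_zero _ _))] at h
  simp only [hpow _ (Q.tSystem_ne_zero _ _)] at h
  beta_reduce
  exact_mod_cast h

theorem isTropicalSolution_degMax (Q : ArrowQuiver V) (u : V) :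
    Q.IsTropicalSolution fun v t => (degMax u (Q.tSystem v t) : ℝ) :=
  Q.isTropicalSolution_of_tropicalization (degMax u) (fun _ _ => degMax_mul u)
    fun _ _ => degMax_add u

/-- The minimal degree is a min-plus tropicalization; the sign change makes it max-plus. -/
theorem isTropicalSolution_neg_degMin (Q : ArrowQuiver V) (u : V) :
    Q.IsTropicalSolution fun v t => ((-degMin u (Q.tSystem v t) : ℤ) : ℝ) :=
  Q.isTropicalSolution_of_tropicalization (fun f => -degMin u f)
    (fun f g hf hg => by rw [degMin_mul u hf hg]; ring)
    fun f g hf hg => by rw [degMin_add u hf hg]; omega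

theorem isTropicalSolution_tropicalTSystem (Q : ArrowQuiver V) (lam : V → ℝ) :
    Q.IsTropicalSolution fun v t => Q.tropicalTSystem lam v t :=
  Q.tropicalTSystem_relation lam

/-! ### Shifts and uniqueness of tropical solutions -/

theorem IsTropicalSolution.shift {Q : ArrowQuiver V} {f : V → ℤ → ℝ} (hf : Q.IsTropicalSolution f)
    (s : ℤ) : Q.IsTropicalSolution fun v t => f v (t + s) := by
  intro v t
  have := hf v (t + s)
  rwa [show t + s + 1 = t + 1 + s by ring, show t + s - 1 = t - 1 + s by ring] at this

/-- The tropical exchange only involves vertices of the opposite color. -/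
theorem IsTropicalSolution.exchange_congr {Q : ArrowQuiver V} {ε : V → Fin 2}
    (hε : Q.IsBipartition ε) {f g : V → ℝ} {v : V} (h : ∀ u, ε u ≠ ε v → f u = g u) :
    max (∑ u, (Q.arrows u v : ℝ) * f u) (∑ w, (Q.arrows v w : ℝ) * f w) =
      max (∑ u, (Q.arrows u v : ℝ) * g u) (∑ w, (Q.arrows v w : ℝ) * g w) := by
  congr 1 <;> refine Finset.sum_congr rfl fun u _ => ?_
  · rcases eq_or_ne (Q.arrows u v) 0 with h0 | h0
    · simp [h0]
    · rw [h u (hε u v h0)]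
  · rcases eq_or_ne (Q.arrows v u) 0 with h0 | h0
    · simp [h0]
    · rw [h u (hε v u h0).symm]

theorem even_add_color_of_ne {a b : Fin 2} (hab : a ≠ b) {t : ℤ}
    (h : Even (t + 1 + ((b : ℕ) : ℤ))) : Even (t + ((a : ℕ) : ℤ)) := by
  rw [Int.even_iff] at h ⊢
  have : (a : ℕ) ≠ b := fun h => hab (Fin.ext h)
  omega

/-- A solution of the tropical `T`-system is determined by its values at the times `ε_v`. -/
theorem IsTropicalSolution.eq_of_init {Q : ArrowQuiver V} {ε : V → Fin 2}
    (hε : Q.IsBipartition ε) {f g : V → ℤ → ℝ} (hf : Q.IsTropicalSolution f)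
    (hg : Q.IsTropicalSolution g) (h0 : ∀ v, f v ((ε v : ℕ) : ℤ) = g v ((ε v : ℕ) : ℤ))
    {v : V} {t : ℤ} (ht : Even (t + ((ε v : ℕ) : ℤ))) : f v t = g v t := by
  -- The values with `t + ε_v` even form a closed system: the neighbors of `v` have the other color,
  -- so at the time in between they have the right parity.
  have hex : ∀ t : ℤ, (∀ v, Even (t + ((ε v : ℕ) : ℤ)) → f v t = g v t) →
      ∀ v, Even (t + 1 + ((ε v : ℕ) : ℤ)) →
        f v (t + 1) + f v (t - 1) = g v (t + 1) + g v (t - 1) := by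
    intro t ih v hv
    rw [hf, hg]
    exact exchange_congr hε fun u hu => ih u (even_add_color_of_ne hu hv)
  -- The recurrence has order two, so the induction carries two consecutive times, in both
  -- directions from `0`. At times `0` and `1` the parity condition selects exactly the vertices
  -- with `ε_v = 0` and `ε_v = 1`, where the initial values apply.
  have key : ∀ t : ℤ, (∀ v, Even (t + ((ε v : ℕ) : ℤ)) → f v t = g v t) ∧
      (∀ v, Even (t + 1 + ((ε v : ℕ) : ℤ)) → f v (t + 1) = g v (t + 1)) := by
    intro t
    induction t using Int.induction_on with
    | zero =>
      refine ⟨fun v hv => ?_, fun v hv => ?_⟩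
      · have : ((ε v : ℕ) : ℤ) = 0 := by
          rw [Int.even_iff] at hv
          omega
        simpa [this] using h0 v
      · have : ((ε v : ℕ) : ℤ) = 1 := by
          rw [Int.even_iff] at hv
          omega
        simpa [this] using h0 v
    | succ n ih =>
      refine ⟨ih.2, fun v hv => ?_⟩
      have h1 := hex _ ih.2 v hv
      rw [add_sub_cancel_right] at h1
      have h2 := ih.1 v (by rw [Int.even_iff] at hv ⊢; omega)
      linarith
    | pred n ih =>
      rw [sub_add_cancel]
      refine ⟨fun v hv => ?_, ih.1⟩
      have hv' : Even (-(n : ℤ) + 1 + ((ε v : ℕ) : ℤ)) := by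
        rw [Int.even_iff] at hv ⊢
        omega
      have h1 := hex _ ih.1 v hv'
      have h2 := ih.2 v hv'
      linarith
  exact (key t).1 v ht

/-! ### Solutions with initial values `δ_u` and `-δ_u` -/

section delta

variable [DecidableEq V]

/-- The sums are minus the numbers of arrows `u → v` and `v → u`. Both are `≤ 0`, and one vanishes
since there is no directed 2-cycle. -/
theorem max_neg_arrows_eq_zero (Q : ArrowQuiver V) (u v : V) :
    max (∑ w, (Q.arrows w v : ℝ) * (if u = w then -1 else 0))
      (∑ w, (Q.arrows v w : ℝ) * (if u = w then -1 else 0)) = 0 := by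
  simp only [mul_ite, mul_neg, mul_one, mul_zero, Finset.sum_ite_eq, Finset.mem_univ, if_true]
  rcases Q.no_two_cycle u v with h | h <;> simp [h]

/-- If a solution has the values `δ_u`, on the vertices of the color of `u`, and then `0`, then the
next two values are `-δ_u` and `0`. The direction of time is that of `s = ±1`. -/
theorem IsTropicalSolution.two_steps {Q : ArrowQuiver V} {ε : V → Fin 2} (hε : Q.IsBipartition ε)
    {f : V → ℤ → ℝ} (hf : Q.IsTropicalSolution f) {u : V} {t s : ℤ} (hs : s = 1 ∨ s = -1)
    (h0 : ∀ v, ε v = ε u → f v t = if u = v then 1 else 0)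
    (h1 : ∀ v, ε v ≠ ε u → f v (t + s) = 0) :
    (∀ v, ε v = ε u → f v (t + 2 * s) = if u = v then -1 else 0) ∧
      ∀ v, ε v ≠ ε u → f v (t + 3 * s) = 0 := by
  -- The relation is symmetric under time reversal, so both signs of `s` are treated at once.
  have hrel : ∀ v r, f v (r + s) + f v (r - s) =
      max (∑ u, (Q.arrows u v : ℝ) * f u r) (∑ w, (Q.arrows v w : ℝ) * f w r) := by
    intro v r
    rcases hs with rfl | rfl
    · exact hf v r
    · rw [add_comm, sub_neg_eq_add]
      exact hf v r
  have h2 : ∀ v, ε v = ε u → f v (t + 2 * s) = if u = v then -1 else 0 := by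
    intro v hv
    have h := hrel v (t + s)
    -- All neighbors of `v` have the value `0` at time `t + s`, so the value at `v` just changes
    -- sign.
    rw [exchange_congr hε (g := fun _ => 0) fun w hw => h1 w (hv ▸ hw), add_sub_cancel_right,
      h0 v hv, show t + s + s = t + 2 * s by ring] at h
    simp only [mul_zero, Finset.sum_const_zero, max_self] at h
    split_ifs at h ⊢ <;> linarith
  refine ⟨h2, fun v hv => ?_⟩
  have h := hrel v (t + 2 * s)
  -- Only the color of `u` enters here, since there are just two colors; the value of `g` on the
  -- other color is immaterial.
  rw [exchange_congr hε (g := fun w => if u = w then -1 else 0) fun w hw => h2 w (by omega),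
    max_neg_arrows_eq_zero, show t + 2 * s - s = t + s by ring, h1 v hv,
    show t + 2 * s + s = t + 3 * s by ring] at h
  linarith

theorem degMax_tSystem (Q : ArrowQuiver V) {ε : V → Fin 2} (hε : Q.IsBipartition ε) (u : V)
    {v : V} {t : ℤ} (ht : Even (t + ((ε v : ℕ) : ℤ))) :
    (degMax u (Q.tSystem v t) : ℝ) =
      Q.tropicalTSystem (fun w => if u = w then 1 else 0) v t := by
  refine IsTropicalSolution.eq_of_init hε (Q.isTropicalSolution_degMax u)
    (Q.isTropicalSolution_tropicalTSystem _) (fun w => ?_) ht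
  simp only [tSystem_init, tropicalTSystem_init, degMax_xvar]
  split_ifs <;> simp

/-- If the tropical `T`-system for `δ_u` takes the initial values `-δ_u` after the shift by `s`,
then this shift is `-degMin u`. -/
theorem neg_degMin_tSystem (Q : ArrowQuiver V) {ε : V → Fin 2} (hε : Q.IsBipartition ε) (u : V)
    {s : ℤ} (hs : ∀ v, Q.tropicalTSystem (fun w => if u = w then 1 else 0) v (((ε v : ℕ) : ℤ) + s) =
      if u = v then -1 else 0) {v : V} {t : ℤ} (ht : Even (t + ((ε v : ℕ) : ℤ))) :
    ((-degMin u (Q.tSystem v t) : ℤ) : ℝ) =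
      Q.tropicalTSystem (fun w => if u = w then 1 else 0) v (t + s) := by
  refine IsTropicalSolution.eq_of_init hε (Q.isTropicalSolution_neg_degMin u)
    ((Q.isTropicalSolution_tropicalTSystem _).shift s) (fun w => ?_) ht
  simp only [tSystem_init, degMin_xvar, hs]
  split_ifs <;> simp

theorem tropicalTSystem_delta_shift (Q : ArrowQuiver V) {ε : V → Fin 2} (hε : Q.IsBipartition ε)
    {u : V} {s : ℤ} (hs : ε u = 0 ∧ s = 1 ∨ ε u = 1 ∧ s = -1) (v : V) :
    Q.tropicalTSystem (fun w => if u = w then 1 else 0) v (((ε v : ℕ) : ℤ) + 2 * s) =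
      if u = v then -1 else 0 := by
  -- The sign of `s` points from the initial time of the color of `u` to that of the other color.
  -- The initial data are thus the slices at `ε_u` and `ε_u + s` required by `two_steps`, and the
  -- shift by `2 * s` moves them to `ε_u + 2 * s` and `ε_u + 3 * s`.
  have hflip : ∀ w, ε w ≠ ε u → ((ε w : ℕ) : ℤ) = ((ε u : ℕ) : ℤ) + s := by
    intro w hw
    have : (ε w : ℕ) ≠ ε u := fun h => hw (Fin.ext h)
    rcases hs with ⟨h, rfl⟩ | ⟨h, rfl⟩ <;> simp only [h, Fin.val_zero, Fin.val_one] at * <;> omega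
  obtain ⟨h2, h3⟩ := (Q.isTropicalSolution_tropicalTSystem fun w => if u = w then 1 else 0).two_steps
    hε (u := u) (t := ((ε u : ℕ) : ℤ)) (s := s) (by tauto)
    (fun w hw => by rw [← hw, tropicalTSystem_init])
    (fun w hw => by
      rw [← hflip w hw, tropicalTSystem_init, if_neg]
      rintro rfl
      exact hw rfl)
  by_cases hv : ε v = ε u
  · rw [hv, h2 v hv]
  · rw [hflip v hv, show ((ε u : ℕ) : ℤ) + s + 2 * s = ((ε u : ℕ) : ℤ) + 3 * s by ring, h3 v hv,
      if_neg]
    rintro rfl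
    exact hv rfl

end delta

end ArrowQuiver

theorem mainTheorem8 {V : Type*} [Fintype V] [DecidableEq V]
    (Q : ArrowQuiver V) (ε : V → Fin 2) (hε : Q.IsBipartition ε) (hQ : Q.IsRecurrent ε)
    (u v : V) (t : ℤ) (ht : Even (t + ((ε v : ℕ) : ℤ))) :
    (ε u = 0 →
      -degMin u (Q.tSystem v t) = degMax u (Q.tSystem v (t + 2)) ∧
      (degMax u (Q.tSystem v (t + 2)) : ℝ) =
        Q.tropicalTSystem (fun w => if u = w then 1 else 0) v (t + 2)) ∧
    (ε u = 1 →
      -degMin u (Q.tSystem v t) = degMax u (Q.tSystem v (t - 2)) ∧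
      (degMax u (Q.tSystem v (t - 2)) : ℝ) =
        Q.tropicalTSystem (fun w => if u = w then 1 else 0) v (t - 2)) := by
  have main : ∀ s : ℤ, (ε u = 0 ∧ s = 1 ∨ ε u = 1 ∧ s = -1) →
      -degMin u (Q.tSystem v t) = degMax u (Q.tSystem v (t + 2 * s)) ∧
      (degMax u (Q.tSystem v (t + 2 * s)) : ℝ) =
        Q.tropicalTSystem (fun w => if u = w then 1 else 0) v (t + 2 * s) := by
    intro s hs
    have hmax := Q.degMax_tSystem hε u (v := v) (t := t + 2 * s)
      (by rw [Int.even_iff] at ht ⊢; omega)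
    have hmin := Q.neg_degMin_tSystem hε u (Q.tropicalTSystem_delta_shift hε hs) ht
    -- Both degrees equal the same real tropical value, so they agree as integers.
    exact ⟨by exact_mod_cast hmin.trans hmax.symm, hmax⟩
  refine ⟨fun h => ?_, fun h => ?_⟩
  · rw [show t + 2 = t + 2 * 1 by ring]
    exact main 1 (Or.inl ⟨h, rfl⟩)
  · rw [show t - 2 = t + 2 * (-1) by ring]
    exact main (-1) (Or.inr ⟨h, rfl⟩)
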